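/- Let $\delta<\frac12$ be a real number and let $k\in\mathbb N$. There is a $d_0$ (depending only on $\delta$ and $k$) such that for every $d\ge d_0$ there exists a set $S\subseteq\mathbb F_2^d$ with the following two properties. - $S$ is $k$-chromatically recurrent: for every partition of $\mathbb F_2^d$ into $k$ (possibly empty) sets $A_1,\dots,A_k$, there is some $j\le k$ with $(A_j-A_j)\cap S\neq\varnothing$. - $S$ is $\delta$-nonrecurrent: there is a set $A\subseteq\mathbb F_2^d$ with $|A|>\delta\,2^d$ and $(A-A)\cap S=\varnothing$. Moreover, one may take $S$ to be the Hamming ball $$H_{2k+1}(\mathbf 1)=\{x\in\mathbb F_2^d : x_j\neq 1\text{ for at most }2k+1\text{ coordinates } j\},\qquad \mathbf 1=(1,\dots,1).$$ Here $A-A=\{a-a' : a,a'\in A\}$. -/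

import Mathlib

open scoped Pointwise

/-- A subset `S` of a finite abelian group `Γ` is `k`-chromatically recurrent if for every partition
of `Γ` into `k` (possibly empty) sets `A₁, …, A_k`, some cell satisfies `(A_j - A_j) ∩ S ≠ ∅`. -/
def IsChromaticallyRecurrent {Γ : Type*} [AddCommGroup Γ] [Finite Γ] (k : ℕ) (S : Set Γ) : Prop :=
  ∀ A : Fin k → Set Γ, (∀ i j, i ≠ j → Disjoint (A i) (A j)) → (⋃ j, A j) = Set.univ →
    ∃ j, ((A j - A j) ∩ S).Nonempty

/-- A subset `S` of a finite abelian group `Γ` is `δ`-nonrecurrent if there is a set `A ⊆ Γ` with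
`|A| > δ |Γ|` and `(A - A) ∩ S = ∅`. -/
def IsNonrecurrent {Γ : Type*} [AddCommGroup Γ] [Finite Γ] (δ : ℝ) (S : Set Γ) : Prop :=
  ∃ A : Set Γ, (A.ncard : ℝ) > δ * (Nat.card Γ : ℝ) ∧ (A - A) ∩ S = ∅

/-- The Hamming ball of radius `r` around `y` in `𝔽₂^d`: the set of `x` such that `y - x` has at most
`r` nonzero coordinates. -/
def hammingBall {d : ℕ} (r : ℕ) (y : Fin d → ZMod 2) : Set (Fin d → ZMod 2) :=
  {x | hammingNorm (y - x) ≤ r}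

/-! Nonrecurrence: with `r = 2k + 1`, a difference of two vectors of weight below `(d - r) / 2` has
weight below `d - r`, so it is at distance more than `r` from `1`. These vectors, their complements
and at most `r + 1` middle layers cover the cube. A layer has at most `2 ^ d / √d` points, so the
density tends to 1/2.

Recurrence is topological, as for Kneser graphs, and radius `k` already suffices. A sign vector is a
pair of disjoint sets of coordinates. If no colour class has a difference within `k` of `1`, then
support sizes (for small supports) and colours of the two parts (for large ones) give a Tucker
labelling with `d - 1` pairs of labels, against `IsTuckerLabelling.le`. The latter follows from
Fan's parity argument: the number of maximal chains with alternating labels is odd, and alternating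
labels without opposites lie in distinct pairs. -/

/-! ### Alternating lists of signed labels -/

/-- Signed labels are encoded as natural numbers: the labels `2 * i` and `2 * i + 1` are opposite. -/
def oppositeLabel (x : ℕ) : ℕ := if x % 2 = 0 then x + 1 else x - 1

theorem oppositeLabel_cast (x : ℕ) : (oppositeLabel x : ZMod 2) = x + 1 := by
  unfold oppositeLabel
  split_ifs with h
  · push_cast; rfl
  · obtain ⟨y, rfl⟩ : ∃ y, x = y + 1 := ⟨x - 1, by omega⟩
    simp [add_assoc, CharTwo.add_self_eq_zero]

theorem oppositeLabel_le {x y : ℕ} (h : x ≤ y) (hxy : y ≠ oppositeLabel x) :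
    oppositeLabel x ≤ oppositeLabel y := by
  unfold oppositeLabel at *
  split_ifs at * <;> omega

theorem oppositeLabel_involutive (x : ℕ) : oppositeLabel (oppositeLabel x) = x := by
  unfold oppositeLabel
  split_ifs <;> omega

theorem zmod_two_add_one_of_ne {a b : ZMod 2} (h : a ≠ b) : a = b + 1 := by
  revert a b; decide

/-- The indicator, in `ZMod 2`, of the lists whose parities alternate, starting with `b`. -/
def alternatingInd : ZMod 2 → List ℕ → ZMod 2
  | _, [] => 1
  | b, x :: l => if (x : ZMod 2) = b then alternatingInd (b + 1) l else 0

theorem erase_cons_of_sorted {c x : ℕ} {l : List ℕ} (h : (c :: l).Pairwise (· ≤ ·)) (hx : x ∈ l) :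
    (c :: l).erase x = c :: l.erase x := by
  by_cases hc : c = x
  · subst hc
    cases l with
    | nil => simp at hx
    | cons d l =>
      have h1 : c ≤ d := by simp at h; exact h.1.1
      have h2 : d ≤ c := by
        rcases List.mem_cons.1 hx with h3 | h3
        · exact h3.ge
        · simp at h; exact h.2.1 _ h3
      obtain rfl := le_antisymm h1 h2
      simp
  · rw [List.erase_cons_tail (by simpa using hc)]

/-- Fan's facet count. An alternating nonempty list stays alternating only on losing an end: the
last element keeps the starting parity, the first changes it. Any other list has an even number of
good deletions. Sortedness makes equal entries adjacent, so erasing a value amounts to erasing a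
position. -/
theorem sum_alternatingInd_erase (l : List ℕ) (hl : l.Pairwise (· ≤ ·)) (b : ZMod 2) :
    (l.map fun x => alternatingInd b (l.erase x)).sum =
      alternatingInd b l + alternatingInd (b + 1) l := by
  induction l generalizing b with
  | nil => simp [alternatingInd, CharTwo.add_self_eq_zero]
  | cons c l ih =>
    have hl' := (List.pairwise_cons.1 hl).2
    have h : (l.map fun x => alternatingInd b ((c :: l).erase x)) =
        l.map fun x => if (c : ZMod 2) = b then alternatingInd (b + 1) (l.erase x) else 0 := by
      refine List.map_congr_left fun x hx => ?_
      rw [erase_cons_of_sorted hl hx, alternatingInd]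
    rw [List.map_cons, List.sum_cons, h, List.erase_cons_head]
    have hb : b + 1 + 1 = b := by rw [add_assoc, CharTwo.add_self_eq_zero, add_zero]
    by_cases hc : (c : ZMod 2) = b
    · have hc' : ¬ (c : ZMod 2) = b + 1 := by rw [hc]; simp
      simp only [alternatingInd, if_pos hc, if_neg hc', ih hl', hb]
      rw [add_comm (alternatingInd (b + 1) l), ← add_assoc, CharTwo.add_self_eq_zero]
      ring
    · have hc' := zmod_two_add_one_of_ne hc
      simp [alternatingInd, if_neg hc, if_pos hc', hb]

theorem alternatingInd_map_oppositeLabel (l : List ℕ) (b : ZMod 2) :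
    alternatingInd b (l.map oppositeLabel) = alternatingInd (b + 1) l := by
  induction l generalizing b with
  | nil => rfl
  | cons c l ih =>
    have h : (c : ZMod 2) + 1 = b ↔ (c : ZMod 2) = b + 1 := by
      generalize (c : ZMod 2) = a
      revert a b; decide
    simp only [List.map_cons, alternatingInd, oppositeLabel_cast, ih, h]

/-- Neighbours differ in parity, hence are distinct; as they are not opposite, their pair indices
differ too. -/
theorem pairwise_div_two_lt {l : List ℕ} (hl : l.Pairwise (· ≤ ·))
    (hopp : ∀ x ∈ l, ∀ y ∈ l, y ≠ oppositeLabel x) {b : ZMod 2} (hb : alternatingInd b l ≠ 0) :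
    l.Pairwise (fun x y => x / 2 < y / 2) := by
  induction l generalizing b with
  | nil => simp
  | cons c l ih =>
    have hcb : (c : ZMod 2) = b := by
      by_contra h; simp [alternatingInd, h] at hb
    rw [alternatingInd, if_pos hcb] at hb
    have hl' := List.pairwise_cons.1 hl
    refine List.pairwise_cons.2 ⟨?_, ih hl'.2
      (fun x hx y hy => hopp x (by simp [hx]) y (by simp [hy])) hb⟩
    cases l with
    | nil => simp
    | cons d l =>
      have hdb : (d : ZMod 2) = b + 1 := by
        by_contra h; simp [alternatingInd, h] at hb
      have h1 : c ≤ d := hl'.1 d (by simp)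
      have h2 : c ≠ d := by
        rintro rfl
        rw [hcb] at hdb
        simp at hdb
      have h3 := hopp c (by simp) d (by simp)
      have h4 := hopp d (by simp) c (by simp)
      have h5 : c / 2 < d / 2 := by
        unfold oppositeLabel at h3 h4
        split_ifs at h3 h4 <;> omega
      intro x hx
      refine h5.trans_le (Nat.div_le_div_right ?_)
      rcases List.mem_cons.1 hx with rfl | hx
      · rfl
      · exact (List.pairwise_cons.1 hl'.2).1 x hx

/-- The indicator, in `ZMod 2`, of the multisets whose elements, put in increasing order, alternate
in parity, starting with `b`. -/
def alternatingSortInd (b : ZMod 2) (M : Multiset ℕ) : ZMod 2 := alternatingInd b (M.sort (· ≤ ·))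

theorem alternatingSortInd_coe {b : ZMod 2} {l : List ℕ} (hl : l.Pairwise (· ≤ ·)) :
    alternatingSortInd b (l : Multiset ℕ) = alternatingInd b l := by
  rw [alternatingSortInd]
  congr 1
  refine List.Perm.eq_of_pairwise' (Multiset.pairwise_sort _ _) hl ?_
  rw [← Multiset.coe_eq_coe, Multiset.sort_eq]

theorem sum_alternatingSortInd_erase (M : Multiset ℕ) (b : ZMod 2) :
    (M.map fun x => alternatingSortInd b (M.erase x)).sum =
      alternatingSortInd b M + alternatingSortInd (b + 1) M := by
  obtain ⟨l, hl, rfl⟩ : ∃ l : List ℕ, l.Pairwise (· ≤ ·) ∧ (l : Multiset ℕ) = M :=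
    ⟨M.sort (· ≤ ·), Multiset.pairwise_sort _ _, Multiset.sort_eq _ _⟩
  simp only [Multiset.coe_erase, Multiset.map_coe, Multiset.sum_coe]
  rw [alternatingSortInd_coe hl, alternatingSortInd_coe hl, ← sum_alternatingInd_erase l hl]
  congr 1
  refine List.map_congr_left fun x _ => ?_
  rw [alternatingSortInd_coe (hl.sublist (List.erase_sublist))]

theorem alternatingSortInd_map_oppositeLabel (M : Multiset ℕ)
    (hopp : ∀ x ∈ M, ∀ y ∈ M, y ≠ oppositeLabel x) (b : ZMod 2) :
    alternatingSortInd b (M.map oppositeLabel) = alternatingSortInd (b + 1) M := by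
  obtain ⟨l, hl, rfl⟩ : ∃ l : List ℕ, l.Pairwise (· ≤ ·) ∧ (l : Multiset ℕ) = M :=
    ⟨M.sort (· ≤ ·), Multiset.pairwise_sort _ _, Multiset.sort_eq _ _⟩
  rw [Multiset.map_coe, alternatingSortInd_coe hl, alternatingSortInd_coe,
    alternatingInd_map_oppositeLabel]
  rw [List.pairwise_map]
  exact hl.imp_of_mem fun hx hy h => oppositeLabel_le h (hopp _ hx _ hy)

theorem card_le_of_alternatingSortInd_ne_zero {M : Multiset ℕ} {m : ℕ}
    (hopp : ∀ x ∈ M, ∀ y ∈ M, y ≠ oppositeLabel x) (hm : ∀ x ∈ M, x / 2 < m) {b : ZMod 2}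
    (hb : alternatingSortInd b M ≠ 0) : M.card ≤ m := by
  obtain ⟨l, hl, rfl⟩ : ∃ l : List ℕ, l.Pairwise (· ≤ ·) ∧ (l : Multiset ℕ) = M :=
    ⟨M.sort (· ≤ ·), Multiset.pairwise_sort _ _, Multiset.sort_eq _ _⟩
  rw [alternatingSortInd_coe hl] at hb
  have h := pairwise_div_two_lt hl hopp hb
  have hnodup : (l.map (· / 2)).Nodup := by
    rw [List.Nodup, List.pairwise_map]
    exact h.imp fun h => h.ne
  have hsub : l.map (· / 2) ⊆ List.range m := by
    intro x hx
    obtain ⟨y, hy, rfl⟩ := List.mem_map.1 hx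
    exact List.mem_range.2 (hm y hy)
  simpa using (List.subperm_of_subset hnodup hsub).length_le

theorem sum_alternatingSortInd_succAbove {n : ℕ} (f : Fin (n + 1) → ℕ) (b : ZMod 2) :
    ∑ j, alternatingSortInd b (Finset.univ.val.map fun i => f (Fin.succAbove j i)) =
      alternatingSortInd b (Finset.univ.val.map f) +
        alternatingSortInd (b + 1) (Finset.univ.val.map f) := by
  rw [← sum_alternatingSortInd_erase, Multiset.map_map]
  refine Finset.sum_congr rfl fun j _ => ?_
  simp only [Function.comp_apply]
  congr 1
  have h : Finset.univ.val.map f =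
      f j ::ₘ Finset.univ.val.map fun i => f (j.succAbove i) := by
    rw [Fin.univ_succAbove n j, Finset.cons_val, Multiset.map_cons, Finset.map_val,
      Multiset.map_map]
    rfl
  rw [h, Multiset.erase_cons_head]

/-! ### Octahedral Tucker lemma -/

/-- The antipode of a sign vector, that is, of a map to `Option Bool` with `none` as zero. -/
def antipode {n : ℕ} (X : Fin n → Option Bool) : Fin n → Option Bool := fun i => (X i).map not

/-- A labelling of the nonzero sign vectors that satisfies the hypotheses of Tucker's lemma: it is
antipodal, and no two comparable sign vectors have opposite labels. -/
structure IsTuckerLabelling {n : ℕ} (lab : (Fin n → Option Bool) → ℕ) : Prop where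
  antipodal : ∀ X, (∃ i, X i ≠ none) → lab (antipode X) = oppositeLabel (lab X)
  ne_opposite : ∀ X Y, (∃ i, X i ≠ none) → (∀ i, X i ≠ none → Y i = X i) →
    lab Y ≠ oppositeLabel (lab X)

theorem IsTuckerLabelling.cons_none {n : ℕ} {lab : (Fin (n + 1) → Option Bool) → ℕ}
    (h : IsTuckerLabelling lab) :
    IsTuckerLabelling fun X : Fin n → Option Bool => lab (Fin.cons none X) where
  antipodal X := by
    rintro ⟨i, hi⟩
    rw [← h.antipodal _ ⟨i.succ, by simpa using hi⟩]
    congr 1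
    funext j
    refine Fin.cases ?_ (fun j => ?_) j <;> simp [antipode]
  ne_opposite X Y := by
    rintro ⟨i, hi⟩ hXY
    refine h.ne_opposite _ _ ⟨i.succ, by simpa using hi⟩ fun j => ?_
    refine Fin.cases ?_ (fun j => ?_) j
    · simp
    · simpa using hXY j

/-- The `j`-th element of the decreasing chain of sign vectors below `s` in which the coordinates
are set to zero in the order given by `ρ`. -/
def signChain {n : ℕ} (ρ : Equiv.Perm (Fin n)) (s : Fin n → Bool) (j : Fin n) :
    Fin n → Option Bool :=
  fun i => if j ≤ ρ i then some (s i) else none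

theorem signChain_ne_none {n : ℕ} (ρ : Equiv.Perm (Fin n)) (s : Fin n → Bool) (j : Fin n) :
    ∃ i, signChain ρ s j i ≠ none :=
  ⟨ρ.symm j, by simp [signChain]⟩

theorem signChain_not {n : ℕ} (ρ : Equiv.Perm (Fin n)) (s : Fin n → Bool) (j : Fin n) :
    signChain ρ (fun i => !s i) j = antipode (signChain ρ s j) := by
  funext i
  simp only [signChain, antipode]
  split_ifs <;> rfl

theorem IsTuckerLabelling.signChain_ne_opposite {n : ℕ} {lab : (Fin n → Option Bool) → ℕ}
    (h : IsTuckerLabelling lab) (ρ : Equiv.Perm (Fin n)) (s : Fin n → Bool) :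
    ∀ x ∈ Finset.univ.val.map fun j => lab (signChain ρ s j),
      ∀ y ∈ Finset.univ.val.map fun j => lab (signChain ρ s j), y ≠ oppositeLabel x := by
  have key : ∀ i j, i ≤ j →
      lab (signChain ρ s i) ≠ oppositeLabel (lab (signChain ρ s j)) := by
    intro i j hij
    refine h.ne_opposite _ _ (signChain_ne_none ρ s j) fun a ha => ?_
    have hj : j ≤ ρ a := by
      by_contra hc; simp [signChain, hc] at ha
    simp [signChain, hj, hij.trans hj]
  intro x hx y hy
  obtain ⟨i, -, rfl⟩ := Multiset.mem_map.1 hx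
  obtain ⟨j, -, rfl⟩ := Multiset.mem_map.1 hy
  rcases le_total j i with hij | hij
  · exact key j i hij
  · intro hc
    refine key i j hij ?_
    rw [hc, oppositeLabel_involutive]

/-- The number modulo 2 of the maximal chains of nonzero sign vectors whose labels, put in
increasing order, alternate in sign, starting with the sign of even labels. -/
def alternatingChainCount {n : ℕ} (lab : (Fin n → Option Bool) → ℕ) : ZMod 2 :=
  ∑ ρ : Equiv.Perm (Fin n), ∑ s : Fin n → Bool,
    alternatingSortInd 0 (Finset.univ.val.map fun j => lab (signChain ρ s j))

theorem sum_bool_cons {n : ℕ} {M : Type*} [AddCommMonoid M] (F : (Fin (n + 1) → Bool) → M) :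
    ∑ s, F s = ∑ s : Fin n → Bool,
      (F (Fin.cons true s) + F fun i => !(Fin.cons true s : Fin (n + 1) → Bool) i) := by
  have h2 : ∀ s : Fin n → Bool, (fun i => !(Fin.cons true s : Fin (n + 1) → Bool) i) =
      Fin.cons false (fun i => !s i) := by
    intro s
    funext j
    refine Fin.cases ?_ (fun j => ?_) j <;> simp
  have h3 : ∑ s : Fin n → Bool, F (Fin.cons false fun i => !s i) =
      ∑ s : Fin n → Bool, F (Fin.cons false s) :=
    Fintype.sum_equiv (Equiv.piCongrRight fun _ => Equiv.boolNot) _ _ fun s => rfl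
  simp only [h2, Finset.sum_add_distrib, h3]
  rw [← Equiv.sum_comp (Fin.consEquiv fun _ : Fin (n + 1) => Bool) F, Fintype.sum_prod_type]
  simp [Fin.consEquiv]

theorem signChain_swap_mul {n : ℕ} (ρ : Equiv.Perm (Fin (n + 1))) (s : Fin (n + 1) → Bool)
    (j : Fin n) (i : Fin (n + 1)) (hi : i ≠ j.succ) :
    signChain (Equiv.swap j.castSucc j.succ * ρ) s i = signChain ρ s i := by
  funext a
  have h : i ≤ Equiv.swap j.castSucc j.succ (ρ a) ↔ i ≤ ρ a := by
    rw [Equiv.swap_apply_def]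
    have : (i : ℕ) ≠ j + 1 := fun h => hi (Fin.ext (by simpa using h))
    split_ifs with h1 h2
    · rw [h1]; simp only [Fin.le_def, Fin.val_succ, Fin.val_castSucc]; omega
    · rw [h2]; simp only [Fin.le_def, Fin.val_succ, Fin.val_castSucc]; omega
    · rfl
  simp [signChain, h]

theorem signChain_update {n : ℕ} (ρ : Equiv.Perm (Fin (n + 1))) (s : Fin (n + 1) → Bool)
    {a : Fin (n + 1)} (ha : ρ a = 0) (b : Bool) (i : Fin n) :
    signChain ρ (Function.update s a b) i.succ = signChain ρ s i.succ := by
  funext c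
  by_cases hc : c = a
  · subst hc; simp [signChain, ha]
  · simp [signChain, Function.update_of_ne hc]

theorem sum_eq_zero_of_involutive {α : Type*} [Fintype α] [DecidableEq α] (F : α → ZMod 2)
    (g : α → α) (hg : Function.Involutive g) (hne : ∀ a, g a ≠ a) (hF : ∀ a, F (g a) = F a) :
    ∑ a, F a = 0 :=
  Finset.sum_involution (fun a _ => g a) (fun a _ => by rw [hF, CharTwo.add_self_eq_zero])
    (fun a _ _ => hne a) (fun _ _ => Finset.mem_univ _) (fun a _ => hg a)

/-- Adding each chain to its antipode reduces the count to facets of chains in the hemisphere where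
coordinate 0 is positive. Interior facets cancel in pairs, leaving the equator. -/
theorem alternatingChainCount_succ {n : ℕ} {lab : (Fin (n + 1) → Option Bool) → ℕ}
    (h : IsTuckerLabelling lab) :
    alternatingChainCount lab =
      alternatingChainCount fun X : Fin n → Option Bool => lab (Fin.cons none X) := by
  let G : Fin (n + 1) → Equiv.Perm (Fin (n + 1)) → (Fin n → Bool) → ZMod 2 := fun j ρ s =>
    alternatingSortInd 0 (Finset.univ.val.map fun i =>
      lab (signChain ρ (Fin.cons true s) (Fin.succAbove j i)))
  have h1 : alternatingChainCount lab = ∑ j, ∑ ρ, ∑ s, G j ρ s := by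
    rw [alternatingChainCount, Finset.sum_comm (s := (Finset.univ : Finset (Fin (n + 1))))]
    refine Finset.sum_congr rfl fun ρ _ => ?_
    rw [sum_bool_cons, Finset.sum_comm]
    refine Finset.sum_congr rfl fun s _ => ?_
    rw [sum_alternatingSortInd_succAbove fun i => lab (signChain ρ (Fin.cons true s) i)]
    rw [← alternatingSortInd_map_oppositeLabel _ (h.signChain_ne_opposite _ _), Multiset.map_map]
    congr 2
    refine Multiset.map_congr rfl fun j _ => ?_
    rw [signChain_not, h.antipodal _ (signChain_ne_none _ _ _)]
    rfl
  -- Without its element `j + 1`, a chain no longer records the order in which two successive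
  -- coordinates vanish.
  have h2 : ∀ j : Fin n, ∑ ρ, ∑ s, G j.succ ρ s = 0 := by
    intro j
    refine sum_eq_zero_of_involutive _ (fun ρ => Equiv.swap j.castSucc j.succ * ρ) ?_ ?_ ?_
    · intro ρ
      simp [← mul_assoc]
    · intro ρ
      simp only [ne_eq, mul_eq_right, Equiv.swap_eq_one_iff]
      exact (Fin.castSucc_lt_succ).ne
    · intro ρ
      refine Finset.sum_congr rfl fun s _ => ?_
      simp only [G]
      congr 1
      refine Multiset.map_congr rfl fun i _ => ?_
      rw [signChain_swap_mul _ _ _ _ (Fin.succAbove_ne _ _)]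
  -- Without its top element, a chain forgets the sign of the coordinate that vanishes first.
  -- Flipping that sign stays in the hemisphere unless the coordinate is 0.
  have h3 : ∀ ρ : Equiv.Perm (Fin (n + 1)), ρ 0 ≠ 0 → ∑ s, G 0 ρ s = 0 := by
    intro ρ hρ
    obtain ⟨a, ha⟩ : ∃ a : Fin n, ρ a.succ = 0 := by
      have h0 : ρ.symm 0 ≠ 0 := fun h0 => hρ (by rw [← h0]; simpa using h0.symm)
      obtain ⟨a, ha⟩ := Fin.exists_succ_eq.2 h0
      exact ⟨a, by rw [ha]; simp⟩
    refine sum_eq_zero_of_involutive _ (fun s => Function.update s a (!s a)) ?_ ?_ ?_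
    · intro s; simp
    · intro s hs
      have := congrFun hs a
      simp at this
    · intro s
      simp only [G, Fin.zero_succAbove]
      congr 1
      refine Multiset.map_congr rfl fun i _ => ?_
      rw [Fin.cons_update, signChain_update _ _ ha]
  rw [h1, Fin.sum_univ_succ, Finset.sum_eq_zero fun j _ => h2 j, add_zero,
    ← Equiv.sum_comp Equiv.Perm.decomposeFin.symm, Fintype.sum_prod_type, Fin.sum_univ_succ,
    Finset.sum_eq_zero fun p _ => Finset.sum_eq_zero fun e _ => h3 _ (by simp), add_zero,
    alternatingChainCount]
  refine Finset.sum_congr rfl fun e _ => Finset.sum_congr rfl fun s _ => ?_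
  simp only [G, Fin.zero_succAbove]
  congr 1
  refine Multiset.map_congr rfl fun i _ => congrArg lab ?_
  funext c
  refine Fin.cases ?_ (fun c => ?_) c
  · simp [signChain]
  · simp [signChain]

theorem alternatingChainCount_eq_one {n : ℕ} {lab : (Fin n → Option Bool) → ℕ}
    (h : IsTuckerLabelling lab) : alternatingChainCount lab = 1 := by
  induction n with
  | zero => simp [alternatingChainCount, alternatingSortInd, alternatingInd]
  | succ n ih => rw [alternatingChainCount_succ h, ih h.cons_none]

/-- The octahedral Tucker lemma: an antipodal labelling of the nonzero sign vectors with `n`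
coordinates without opposite labels on comparable vectors uses at least `n` pairs of labels. -/
theorem IsTuckerLabelling.le {n m : ℕ} {lab : (Fin n → Option Bool) → ℕ}
    (h : IsTuckerLabelling lab) (hm : ∀ X, (∃ i, X i ≠ none) → lab X / 2 < m) : n ≤ m := by
  have h1 : alternatingChainCount lab ≠ 0 := by rw [alternatingChainCount_eq_one h]; simp
  obtain ⟨ρ, -, hρ⟩ := Finset.exists_ne_zero_of_sum_ne_zero h1
  obtain ⟨s, -, hs⟩ := Finset.exists_ne_zero_of_sum_ne_zero hρ
  have h2 := card_le_of_alternatingSortInd_ne_zero (h.signChain_ne_opposite ρ s) (m := m)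
    (by
      intro x hx
      obtain ⟨j, -, rfl⟩ := Multiset.mem_map.1 hx
      exact hm _ (signChain_ne_none ρ s j)) hs
  simpa using h2

/-! ### From colourings to Tucker labellings -/

/-- The indicator vector of the coordinates at which a sign vector takes the value `b`. -/
def signPart {d : ℕ} (b : Bool) (X : Fin d → Option Bool) : Fin d → ZMod 2 :=
  fun i => if X i = some b then 1 else 0

theorem signPart_antipode {d : ℕ} (b : Bool) (X : Fin d → Option Bool) :
    signPart b (antipode X) = signPart (!b) X := by
  funext i
  have h : (X i).map not = some b ↔ X i = some !b := by
    generalize X i = a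
    revert a b
    decide
  simp [signPart, antipode, h]

theorem signPart_true_ne_false {d : ℕ} {X : Fin d → Option Bool} (h : ∃ i, X i ≠ none) :
    signPart true X ≠ signPart false X := by
  obtain ⟨i, hi⟩ := h
  intro h
  have h := congrFun h i
  simp only [signPart] at h
  rcases hX : X i with _ | _ | _ <;> simp [hX] at hi h

/-- The number of nonzero coordinates of a sign vector. -/
def supportCard {d : ℕ} (X : Fin d → Option Bool) : ℕ := (Finset.univ.filter (X · ≠ none)).card

theorem supportCard_antipode {d : ℕ} (X : Fin d → Option Bool) :
    supportCard (antipode X) = supportCard X := by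
  simp [supportCard, antipode]

theorem supportCard_pos {d : ℕ} {X : Fin d → Option Bool} (h : ∃ i, X i ≠ none) :
    0 < supportCard X := by
  obtain ⟨i, hi⟩ := h
  exact Finset.card_pos.2 ⟨i, by simpa using hi⟩

theorem supportCard_le {d : ℕ} {X Y : Fin d → Option Bool} (h : ∀ i, X i ≠ none → Y i = X i) :
    supportCard X ≤ supportCard Y := by
  refine Finset.card_le_card fun i hi => ?_
  simp only [Finset.mem_filter, Finset.mem_univ, true_and] at hi ⊢
  rwa [h i hi]

theorem eq_of_supportCard_le {d : ℕ} {X Y : Fin d → Option Bool}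
    (h : ∀ i, X i ≠ none → Y i = X i) (hc : supportCard Y ≤ supportCard X) : Y = X := by
  have hs : Finset.univ.filter (X · ≠ none) = Finset.univ.filter (Y · ≠ none) := by
    refine Finset.eq_of_subset_of_card_le (fun i hi => ?_) hc
    simp only [Finset.mem_filter, Finset.mem_univ, true_and] at hi ⊢
    rwa [h i hi]
  funext i
  by_cases hi : X i = none
  · have : i ∉ Finset.univ.filter (Y · ≠ none) := by rw [← hs]; simp [hi]
    rw [hi]; simpa using this
  · exact h i hi

theorem hammingNorm_one_sub_signPart_le {d : ℕ} {X Y : Fin d → Option Bool}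
    (h : ∀ i, X i ≠ none → Y i = X i) (b : Bool) :
    hammingNorm (1 - (signPart b X - signPart (!b) Y)) ≤ d - supportCard X := by
  have h1 : d - supportCard X = (Finset.univ.filter (X · = none)).card := by
    have := Finset.card_filter_add_card_filter_not (s := (Finset.univ : Finset (Fin d)))
      (X · = none)
    simp only [Finset.card_univ, Fintype.card_fin] at this
    simp only [supportCard, ne_eq]
    omega
  rw [h1, hammingNorm]
  refine Finset.card_le_card fun i hi => ?_
  simp only [Finset.mem_filter, Finset.mem_univ, true_and] at hi ⊢
  by_contra hX
  refine hi ?_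
  simp only [Pi.sub_apply, Pi.one_apply, signPart, h i hX]
  cases b <;> rcases hx : X i with _ | _ | _ <;> simp [hx] at hX ⊢

theorem exists_eq_color_hammingNorm_le {d k : ℕ} (hd : k + 1 ≤ d)
    (c : (Fin d → ZMod 2) → ℕ) (hc : ∀ x, c x < k) :
    ∃ x y, c x = c y ∧ hammingNorm (1 - (x - y)) ≤ k := by
  by_contra! hcon
  obtain ⟨t, rfl⟩ : ∃ t, d = t + (k + 1) := ⟨d - (k + 1), by omega⟩
  let e := Fintype.equivFin (Fin (t + (k + 1)) → ZMod 2)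
  -- Small supports use `t` pairs of labels, large ones at most `k`. The enumeration `e` only serves
  -- to choose a sign that the antipode reverses.
  let lab : (Fin (t + (k + 1)) → Option Bool) → ℕ := fun X =>
    if supportCard X ≤ t then
      2 * (supportCard X - 1) + if e (signPart true X) < e (signPart false X) then 0 else 1
    else 2 * (t + min (c (signPart true X)) (c (signPart false X))) +
      if c (signPart true X) < c (signPart false X) then 0 else 1
  have hopp : ∀ (X Y : Fin (t + (k + 1)) → Option Bool) (b : Bool), t < supportCard X →
      (∀ i, X i ≠ none → Y i = X i) → c (signPart b X) ≠ c (signPart (!b) Y) := by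
    intro X Y b hX hXY h
    have h1 := hcon _ _ h
    have h2 := hammingNorm_one_sub_signPart_le hXY b
    omega
  have hlab : IsTuckerLabelling lab := by
    constructor
    · intro X hX
      simp only [lab, supportCard_antipode, signPart_antipode, Bool.not_true, Bool.not_false]
      by_cases hs : supportCard X ≤ t
      · have he : (e (signPart true X) : ℕ) ≠ e (signPart false X) := fun h =>
          signPart_true_ne_false hX (e.injective (Fin.ext h))
        simp only [if_pos hs, Fin.lt_def]
        unfold oppositeLabel
        split_ifs <;> omega
      · have hne := hopp X X true (by omega) fun _ _ => rfl
        simp only [Bool.not_true] at hne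
        simp only [if_neg hs]
        unfold oppositeLabel
        split_ifs <;> omega
    · intro X Y hX hXY h
      have h0 := supportCard_pos hX
      have h1 := supportCard_le hXY
      have hdiv : lab Y / 2 = lab X / 2 := by
        rw [h]; unfold oppositeLabel; split_ifs <;> omega
      have hne : lab Y ≠ lab X := by
        rw [h]; unfold oppositeLabel; split_ifs <;> omega
      by_cases hY : supportCard Y ≤ t
      · refine hne (congrArg lab (eq_of_supportCard_le hXY ?_))
        simp only [lab, if_pos hY, if_pos (h1.trans hY)] at hdiv
        split_ifs at hdiv <;> omega
      · by_cases hXt : supportCard X ≤ t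
        · simp only [lab, if_neg hY, if_pos hXt] at hdiv
          split_ifs at hdiv <;> omega
        -- Equal minima attained on opposite sides would give a part of `X` the colour of the
        -- opposite part of `Y`.
        · have hT := hopp X Y true (by omega) hXY
          have hF := hopp X Y false (by omega) hXY
          simp only [Bool.not_true, Bool.not_false] at hT hF
          simp only [lab, if_neg hY, if_neg hXt] at hdiv hne
          split_ifs at hdiv hne <;> omega
  have := hlab.le (m := t + k) (fun X hX => by
    have h0 := supportCard_pos hX
    have h1 := hc (signPart true X)
    simp only [lab]
    split_ifs <;> omega)
  omega

theorem isChromaticallyRecurrent_hammingBall {d k r : ℕ} (hd : k + 1 ≤ d) (hr : k ≤ r) :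
    IsChromaticallyRecurrent k (hammingBall r (1 : Fin d → ZMod 2)) := by
  intro A _ hA
  have hmem : ∀ x, ∃ j, x ∈ A j := fun x => Set.mem_iUnion.1 (hA ▸ Set.mem_univ x)
  choose c hc using hmem
  obtain ⟨x, y, hxy, h⟩ := exists_eq_color_hammingNorm_le hd (fun x => (c x : ℕ))
    fun x => (c x).2
  exact ⟨c x, x - y, Set.sub_mem_sub (hc x) (Fin.ext hxy ▸ hc y), h.trans hr⟩

/-! ### Middle layers and nonrecurrence -/

/-- The factor `2n + 1` reduces the induction to `(2n + 1)(2n + 3) ≤ (2n + 2)²`. -/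
theorem centralBinom_sq_mul_le (n : ℕ) : n.centralBinom ^ 2 * (2 * n + 1) ≤ 16 ^ n := by
  induction n with
  | zero => simp
  | succ n ih =>
    have h := Nat.succ_mul_centralBinom_succ n
    refine Nat.le_of_mul_le_mul_left (c := (n + 1) ^ 2) ?_ (by positivity)
    calc (n + 1) ^ 2 * ((n + 1).centralBinom ^ 2 * (2 * (n + 1) + 1))
        = ((n + 1) * (n + 1).centralBinom) ^ 2 * (2 * n + 3) := by ring
      _ = 4 * (2 * n + 1) * (2 * n + 3) * (n.centralBinom ^ 2 * (2 * n + 1)) := by rw [h]; ring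
      _ ≤ 4 * (2 * n + 1) * (2 * n + 3) * 16 ^ n := by gcongr
      _ ≤ (n + 1) ^ 2 * 16 * 16 ^ n := Nat.mul_le_mul_right _ (by nlinarith)
      _ = (n + 1) ^ 2 * 16 ^ (n + 1) := by ring

theorem choose_half_sq_mul_le (d : ℕ) : (d.choose (d / 2)) ^ 2 * d ≤ 4 ^ d := by
  obtain ⟨n, rfl | rfl⟩ := d.even_or_odd'
  · have h := centralBinom_sq_mul_le n
    rw [Nat.centralBinom_eq_two_mul_choose] at h
    rw [Nat.mul_div_cancel_left n two_pos, pow_mul]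
    exact (Nat.mul_le_mul_left _ (Nat.le_succ _)).trans h
  · have h := centralBinom_sq_mul_le n
    have h2 : (2 * n + 1) / 2 = n := by omega
    have h3 : (2 * n + 1).choose n ≤ 2 * n.centralBinom := by
      cases n with
      | zero => simp
      | succ n =>
        rw [Nat.choose_succ_succ]
        have := Nat.choose_le_centralBinom n (n + 1)
        have := Nat.choose_le_centralBinom (n + 1) (n + 1)
        simp only [Nat.succ_eq_add_one] at *
        omega
    rw [h2, pow_succ 4, pow_mul]
    calc (2 * n + 1).choose n ^ 2 * (2 * n + 1) ≤ (2 * n.centralBinom) ^ 2 * (2 * n + 1) := by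
          gcongr
      _ = n.centralBinom ^ 2 * (2 * n + 1) * 4 := by ring
      _ ≤ 16 ^ n * 4 := by gcongr

theorem eventually_mul_choose_half_lt (C ε : ℝ) (hε : 0 < ε) :
    ∀ᶠ d : ℕ in Filter.atTop, C * (d.choose (d / 2) : ℝ) < ε * 2 ^ d := by
  filter_upwards [Filter.eventually_gt_atTop (Nat.ceil ((C / ε) ^ 2))] with d hd
  have hd' : (C / ε) ^ 2 < d := Nat.lt_of_ceil_lt hd
  have h : ((d.choose (d / 2) : ℝ)) ^ 2 * d ≤ (2 ^ d) ^ 2 := by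
    have := choose_half_sq_mul_le d
    rw [← pow_mul, mul_comm d 2, pow_mul]
    norm_num
    exact_mod_cast this
  have hpos : (0 : ℝ) < d.choose (d / 2) := by
    exact_mod_cast Nat.choose_pos (Nat.div_le_self d 2)
  refine lt_of_pow_lt_pow_left₀ 2 (by positivity) ?_
  have hC2 : C ^ 2 < ε ^ 2 * d := by
    rw [div_pow, div_lt_iff₀ (by positivity)] at hd'
    linarith
  calc (C * (d.choose (d / 2) : ℝ)) ^ 2 = C ^ 2 * (d.choose (d / 2) : ℝ) ^ 2 := by ring
    _ < ε ^ 2 * d * (d.choose (d / 2) : ℝ) ^ 2 := by gcongr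
    _ = ε ^ 2 * ((d.choose (d / 2) : ℝ) ^ 2 * d) := by ring
    _ ≤ ε ^ 2 * (2 ^ d) ^ 2 := by gcongr
    _ = (ε * 2 ^ d) ^ 2 := by ring

theorem card_hammingNorm_eq_le (d j : ℕ) :
    (Finset.univ.filter fun x : Fin d → ZMod 2 => hammingNorm x = j).card ≤ d.choose (d / 2) := by
  refine le_trans ?_ (Nat.choose_le_middle j d)
  rw [← Finset.card_fin d, ← Finset.card_powersetCard, Finset.card_fin]
  refine Finset.card_le_card_of_injOn (fun x => Finset.univ.filter (x · ≠ 0)) ?_ ?_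
  · intro x hx
    simpa [hammingNorm, Finset.mem_powersetCard] using hx
  · intro x _ y _ hxy
    funext i
    have := Finset.ext_iff.1 hxy i
    simp only [Finset.mem_filter, Finset.mem_univ, true_and] at this
    generalize x i = a at *
    generalize y i = b at *
    revert a b
    decide

theorem hammingNorm_one_sub_add {d : ℕ} (x : Fin d → ZMod 2) :
    hammingNorm (1 - x) + hammingNorm x = d := by
  have h := Finset.card_filter_add_card_filter_not (s := (Finset.univ : Finset (Fin d)))
    (x · ≠ 0)
  simp only [Finset.card_univ, Fintype.card_fin] at h
  rw [hammingNorm, hammingNorm, add_comm]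
  convert h using 3
  ext i
  simp only [Finset.mem_filter, Finset.mem_univ, true_and, Pi.sub_apply, Pi.one_apply]
  generalize x i = a
  revert a
  decide

theorem two_pow_le_card_hammingNorm_lt (d r : ℕ) :
    2 ^ d ≤ 2 * (Finset.univ.filter fun x : Fin d → ZMod 2 => 2 * hammingNorm x + r < d).card +
      (r + 1) * d.choose (d / 2) := by
  let A := Finset.univ.filter fun x : Fin d → ZMod 2 => 2 * hammingNorm x + r < d
  let L : ℕ → Finset (Fin d → ZMod 2) := fun j => Finset.univ.filter fun x => hammingNorm x = j
  have hcover : (Finset.univ : Finset (Fin d → ZMod 2)) ⊆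
      A ∪ A.image (1 - ·) ∪ (Finset.range (r + 1)).biUnion fun i => L ((d - r + 1) / 2 + i) := by
    intro x _
    have h := hammingNorm_one_sub_add x
    simp only [Finset.mem_union, Finset.mem_image, Finset.mem_biUnion, Finset.mem_range, A, L,
      Finset.mem_filter, Finset.mem_univ, true_and]
    by_cases h1 : 2 * hammingNorm x + r < d
    · exact .inl (.inl h1)
    by_cases h2 : 2 * hammingNorm (1 - x) + r < d
    · exact .inl (.inr ⟨1 - x, h2, by simp⟩)
    -- The remaining weights `w` satisfy `d - r ≤ 2w ≤ d + r`; the least candidate is `(d - r) / 2`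
    -- rounded up.
    · exact .inr ⟨hammingNorm x - (d - r + 1) / 2, by omega, by omega⟩
  have h1 := Finset.card_le_card hcover
  have h2 : ((Finset.range (r + 1)).biUnion fun i => L ((d - r + 1) / 2 + i)).card ≤
      (r + 1) * d.choose (d / 2) := by
    refine Finset.card_biUnion_le.trans ?_
    refine (Finset.sum_le_card_nsmul _ _ _ fun i _ => card_hammingNorm_eq_le d _).trans ?_
    simp
  have h3 : (A.image (1 - ·)).card ≤ A.card := Finset.card_image_le
  have h4 := Finset.card_union_le (A ∪ A.image (1 - ·))
    ((Finset.range (r + 1)).biUnion fun i => L ((d - r + 1) / 2 + i))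
  have h5 := Finset.card_union_le A (A.image (1 - ·))
  have h6 : (Finset.univ : Finset (Fin d → ZMod 2)).card = 2 ^ d := by
    simp [Finset.card_univ, ZMod.card]
  change 2 ^ d ≤ 2 * A.card + _
  omega

theorem isNonrecurrent_hammingBall {d r : ℕ} {δ : ℝ}
    (h : ((r : ℝ) + 1) * (d.choose (d / 2) : ℝ) < (1 - 2 * δ) * 2 ^ d) :
    IsNonrecurrent δ (hammingBall r (1 : Fin d → ZMod 2)) := by
  refine ⟨{x | 2 * hammingNorm x + r < d}, ?_, ?_⟩
  · have h1 : (2 : ℝ) ^ d ≤ 2 * ((Finset.univ.filter fun x : Fin d → ZMod 2 =>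
        2 * hammingNorm x + r < d).card : ℝ) + ((r : ℝ) + 1) * (d.choose (d / 2) : ℝ) := by
      exact_mod_cast two_pow_le_card_hammingNorm_lt d r
    have h2 : Nat.card (Fin d → ZMod 2) = 2 ^ d := by simp
    have h3 : {x : Fin d → ZMod 2 | 2 * hammingNorm x + r < d}.ncard =
        (Finset.univ.filter fun x : Fin d → ZMod 2 => 2 * hammingNorm x + r < d).card := by
      rw [← Set.ncard_coe_finset]
      simp
    rw [h2, h3]
    push_cast
    linarith
  · refine Set.eq_empty_of_forall_notMem ?_
    rintro _ ⟨⟨x, hx, y, hy, rfl⟩, hS⟩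
    have h1 : hammingNorm (x - y) ≤ hammingNorm x + hammingNorm y := by
      have := hammingDist_triangle y 0 x
      rwa [hammingDist_eq_hammingNorm, hammingDist_zero_right, hammingDist_zero_left,
        neg_add_eq_sub, add_comm] at this
    have h2 := hammingNorm_one_sub_add (x - y)
    simp only [hammingBall, Set.mem_ofPred_eq] at hx hy hS
    omega

theorem theorem3 (δ : ℝ) (hδ : δ < 1 / 2) (k : ℕ) :
    ∃ d₀ : ℕ, ∀ d : ℕ, d₀ ≤ d →
      ∃ S : Set (Fin d → ZMod 2),
        S = hammingBall (2 * k + 1) (1 : Fin d → ZMod 2) ∧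
        IsChromaticallyRecurrent k S ∧ IsNonrecurrent δ S := by
  obtain ⟨d₀, h⟩ := Filter.eventually_atTop.1
    (eventually_mul_choose_half_lt (((2 * k + 1 : ℕ) : ℝ) + 1) (1 - 2 * δ) (by linarith))
  refine ⟨max d₀ (k + 1), fun d hd => ⟨_, rfl, ?_, ?_⟩⟩
  · exact isChromaticallyRecurrent_hammingBall (le_of_max_le_right hd) (by omega)
  · exact isNonrecurrent_hammingBall (h d (le_of_max_le_left hd))
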